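/- **Setting.** Let $1\le m\le T$ be integers. Let $Z^1,\dots,Z^T$ be sets with $Z^k\subseteq \mathbb R\times\mathbb R^{n_k}\times\mathbb R^m$; a point of $Z^k$ is written $(r,\mathbf x,\mathbf y)$ (reward, auxiliary decision, impact). Let $\Psi\subseteq\mathbb R^m$ be the goal set, and let $Q\subseteq\mathbb R^m$ and $C\subseteq\mathbb R^m$. **A1.** There are $(r^k,\mathbf x^k,\mathbf y^k)\in Z^k$, $k=1,\dots,T$, with $\sum_{k}\mathbf y^k\in T\Psi$; every $Z^k$ is compact; $Q$ is compact and convex, $C$ is a nonempty closed convex cone, and $\Psi=Q+C$ (Minkowski sum). **A2** (with constants $d_y,d_r\ge 0$ and $\underline d>0$). For every $k$: (a) $\|\mathbf y-\mathbf v\|_\infty\le d_y$ for all $(r,\mathbf x,\mathbf y)\in Z^k$ and $\mathbf v\in Q$; (b) there is $(\tilde r,\tilde{\mathbf x},\tilde{\mathbf y})\in\operatorname{conv}(Z^k)$ such that $\tilde r\ge \max_{(r,\mathbf x,\mathbf y)\in Z^k} r-d_r$ and the closed Euclidean ball of radius $\underline d$ around $\tilde{\mathbf y}$ is contained in $\Psi$.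 **Benchmark.** $$z^R=\max\Big\{\sum_{k=1}^T r^k:\ (r^k,\mathbf x^k,\mathbf y^k)\in\operatorname{conv}(Z^k)\text{ for all }k,\ \sum_{k=1}^T\mathbf y^k\in T\Psi\Big\}.$$ **Algorithm.** Let $C^\circ=\{\mathbf u:\mathbf u^\top\mathbf v\le 0\ \forall\,\mathbf v\in C\}$ and $\eta^t=\min\{1/m,\,1/\sqrt{mt}\}$. On the input $\Omega^1,\dots,\Omega^T$, start with $\mathbf p^1=\mathbf 0$; for $t=1,\dots,T$ pick $$(\hat r^t,\hat{\mathbf x}^t,\hat{\mathbf y}^t)\in\arg\max\{r-(\mathbf p^t)^\top\mathbf y:(r,\mathbf x,\mathbf y)\in\Omega^t\},\qquad \hat{\mathbf v}^t\in\arg\max_{\mathbf v\in Q}(\mathbf p^t)^\top\mathbf v,$$ and let $\mathbf p^{t+1}$ be the Euclidean projection of $\mathbf p^t-\eta^t(\hat{\mathbf v}^t-\hat{\mathbf y}^t)$ onto $C^\circ$. In the uniform random permutation model the input is $\Omega^t=Z^{\pi(t)}$ with $\pi$ a uniformly random permutation of $\{1,\dots,T\}$. The algorithm is online: which maximizers it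 picks at time $t$ may depend in any way on $\pi(1),\dots,\pi(t)$, but not on $\pi(t+1),\dots,\pi(T)$. Let $\mathbf{Reward}=\sum_{t=1}^T\hat r^t$. **Theorem.** For all $d_y,d_r\ge0$ and $\underline d>0$ there is a constant $K>0$, depending only on $d_y,d_r,\underline d$, such that for all $1\le m\le T$ and all data $Z^1,\dots,Z^T,\Psi,Q,C$ satisfying A1 and A2 with these constants, the maximum defining $z^R$ is attained, the algorithm can be carried out online, and for every such way of picking the maximizers $$\mathbb E_\pi[\mathbf{Reward}]\ \ge\ z^R-K\,\sqrt{m\log(\max\{m,2\})}\,\sqrt T .$$ For $m\ge2$ the error term is exactly $O(\sqrt{m\log m}\,\sqrt T)$. -/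

import Mathlib

open scoped Pointwise

/-- The space `ℝ^k` with its Euclidean norm. -/
abbrev Vec (k : ℕ) : Type := EuclideanSpace ℝ (Fin k)

/-- Local decision variables `(r, x, y)`: reward `r ∈ ℝ`, auxiliary decision `x ∈ ℝ^n`,
impact `y ∈ ℝ^m`. -/
abbrev LocalVar (n m : ℕ) : Type := ℝ × Vec n × Vec m

namespace LocalVar

/-- The reward component `r` of `(r, x, y)`. -/
def reward {n m : ℕ} (w : LocalVar n m) : ℝ := w.1

/-- The impact component `y` of `(r, x, y)`. -/
def impact {n m : ℕ} (w : LocalVar n m) : Vec m := w.2.2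

end LocalVar

/-- The objective values `∑ t, r^t` attained by the feasible points of the offline problem with
local sets `Ω^1, …, Ω^T` and goal set `Ψ`, i.e. by the families `(r^t, x^t, y^t) ∈ Ω^t` with
`∑ t, y^t ∈ T Ψ`. -/
def offlineValues {T m : ℕ} {n : Fin T → ℕ} (Ω : ∀ t, Set (LocalVar (n t) m))
    (Ψ : Set (Vec m)) : Set ℝ :=
  {z | ∃ w : ∀ t, LocalVar (n t) m, (∀ t, w t ∈ Ω t) ∧
    ∑ t, (w t).impact ∈ (T : ℝ) • Ψ ∧ z = ∑ t, (w t).reward}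

/-- The objective values of the partially convexified problem, in which every `Ω^t` is replaced by
its convex hull. -/
def convexifiedValues {T m : ℕ} {n : Fin T → ℕ} (Ω : ∀ t, Set (LocalVar (n t) m))
    (Ψ : Set (Vec m)) : Set ℝ :=
  offlineValues (fun t => convexHull ℝ (Ω t)) Ψ

/-- The optimal value `z^R` of the partially convexified problem. -/
noncomputable def zR {T m : ℕ} {n : Fin T → ℕ} (Ω : ∀ t, Set (LocalVar (n t) m))
    (Ψ : Set (Vec m)) : ℝ :=
  sSup (convexifiedValues Ω Ψ)

/-- Assumption A1. A `ProperCone` is a nonempty closed convex cone. -/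
structure AssumptionA1 {T m : ℕ} {n : Fin T → ℕ} (Ω : ∀ t, Set (LocalVar (n t) m))
    (Ψ Q : Set (Vec m)) (C : ProperCone ℝ (Vec m)) : Prop where
  feasible : (offlineValues Ω Ψ).Nonempty
  compact_local : ∀ t, IsCompact (Ω t)
  compact_Q : IsCompact Q
  convex_Q : Convex ℝ Q
  decomposition : Ψ = Q + (C : Set (Vec m))

/-- Assumption A2 with the constants `dy`, `dr` and `dlow`. -/
structure AssumptionA2 {T m : ℕ} {n : Fin T → ℕ} (Ω : ∀ t, Set (LocalVar (n t) m))
    (Ψ Q : Set (Vec m)) (dy dr dlow : ℝ) : Prop where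
  bounded_impact : ∀ t, ∀ w ∈ Ω t, ∀ v ∈ Q, ∀ i, |w.impact i - v i| ≤ dy
  strongly_feasible : ∀ t, ∃ w' ∈ convexHull ℝ (Ω t),
    (∀ w ∈ Ω t, w.reward - dr ≤ w'.reward) ∧ Metric.closedBall w'.impact dlow ⊆ Ψ

/-- The polar cone `{u | uᵀ v ≤ 0 for all v ∈ C}`. -/
def polarCone {m : ℕ} (C : ProperCone ℝ (Vec m)) : Set (Vec m) :=
  {u | ∀ v ∈ C, inner ℝ u v ≤ 0}

/-- `q` is a Euclidean projection of `x` onto `K`, i.e. a nearest point of `K`. -/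
def IsProjection {m : ℕ} (K : Set (Vec m)) (x q : Vec m) : Prop :=
  q ∈ K ∧ ∀ u ∈ K, ‖x - q‖ ≤ ‖x - u‖

/-- The stepsizes `η^t = min {1/m, 1/√(m t)}`; the time steps `1, …, T` are the elements
`0, …, T - 1` of `Fin T`, hence the shift by one. -/
noncomputable def stepsize (m : ℕ) {T : ℕ} (t : Fin T) : ℝ :=
  min (1 / (m : ℝ)) (1 / Real.sqrt ((m : ℝ) * ((t : ℝ) + 1)))

/-- The sequences `w^t = (r̂^t, x̂^t, ŷ^t)`, `v^t = v̂^t` (time steps in `Fin T`) and `p^1, …, p^{T+1}`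
(indexed by `Fin (T + 1)`) are produced by the dual-based algorithm on the input `Ω^1, …, Ω^T`
with stepsizes `η`. The maximizers are arbitrary. -/
structure IsAlgorithmRun {T m : ℕ} {n : Fin T → ℕ} (Ω : ∀ t, Set (LocalVar (n t) m))
    (Q : Set (Vec m)) (C : ProperCone ℝ (Vec m)) (η : Fin T → ℝ)
    (w : ∀ t, LocalVar (n t) m) (v : Fin T → Vec m) (p : Fin (T + 1) → Vec m) : Prop where
  init : p 0 = 0
  local_mem : ∀ t, w t ∈ Ω t
  local_max : ∀ t, ∀ w' ∈ Ω t,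
    w'.reward - inner ℝ (p t.castSucc) w'.impact ≤
      (w t).reward - inner ℝ (p t.castSucc) (w t).impact
  support_mem : ∀ t, v t ∈ Q
  support_max : ∀ t, ∀ v' ∈ Q, inner ℝ (p t.castSucc) v' ≤ inner ℝ (p t.castSucc) (v t)
  update : ∀ t, IsProjection (polarCone C)
    (p t.castSucc - η t • (v t - (w t).impact)) (p t.succ)

/-- An online execution of the algorithm in the random permutation model with underlying sets
`Z^1, …, Z^T`: for every permutation `π` a run on the input `Ω^t = Z^{π(t)}`, such that the
choices made at time `t` (which maximizers are picked) depend only on what has been revealed up to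
time `t`, i.e. on `π(1), …, π(t)`. -/
structure OnlineExecution {T m : ℕ} {n : Fin T → ℕ} (Z : ∀ k, Set (LocalVar (n k) m))
    (Q : Set (Vec m)) (C : ProperCone ℝ (Vec m)) (η : Fin T → ℝ) where
  /-- the decisions `(r̂^t, x̂^t, ŷ^t)` -/
  w : ∀ (π : Equiv.Perm (Fin T)) (t : Fin T), LocalVar (n (π t)) m
  /-- the points `v̂^t` of `Q` -/
  v : Equiv.Perm (Fin T) → Fin T → Vec m
  /-- the dual multipliers -/
  p : Equiv.Perm (Fin T) → Fin (T + 1) → Vec m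
  isRun : ∀ π : Equiv.Perm (Fin T),
    IsAlgorithmRun (fun t => Z (π t)) Q C η (w π) (v π) (p π)
  nonanticipating : ∀ (π π' : Equiv.Perm (Fin T)) (t : Fin T), (∀ s ≤ t, π s = π' s) →
    (⟨π t, w π t⟩ : Σ k : Fin T, LocalVar (n k) m) = ⟨π' t, w π' t⟩ ∧ v π t = v π' t

/-- The accumulated reward `∑ t, r̂^t` of an execution when the permutation is `π`. -/
def OnlineExecution.totalReward {T m : ℕ} {n : Fin T → ℕ} {Z : ∀ k, Set (LocalVar (n k) m)}
    {Q : Set (Vec m)} {C : ProperCone ℝ (Vec m)} {η : Fin T → ℝ}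
    (A : OnlineExecution Z Q C η) (π : Equiv.Perm (Fin T)) : ℝ :=
  ∑ t, (A.w π t).reward

/-- Expectation with respect to a uniformly random permutation of the `T` time steps. -/
noncomputable def permExpectation {T : ℕ} (f : Equiv.Perm (Fin T) → ℝ) : ℝ :=
  (∑ π, f π) / (T.factorial : ℝ)

/-! Fix an optimal convexified family `u` whose mean impact `ψ` lies in the goal set. Multipliers in
the polar cone make the support point `v t` optimal over all of `Ψ = Q + C`. Lagrangian optimality
at each step then bounds the reward below by the benchmark minus two sums of inner products with
`p`, one against `v t - (w t).impact`, the other against `(u t).impact - ψ`.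

The first is the regret against `0` of projected gradient descent. Strong feasibility pulls the
multipliers back to the origin, so their norms are bounded independently of `m` and `T`
(`IsAlgorithmRun.norm_sq_le`), and the regret is O(√(mT)) (`IsAlgorithmRun.regret_le`).

The second is controlled only in expectation. The vectors `(u k).impact - ψ` sum to zero, and the
multiplier depends only on the past. By exchangeability the next sample can be replaced by the
average of the unseen ones, whose mean norm is O(√m / √(T - t)) (`sum_perm_inner_le`). Summing over
`t` again gives O(√(mT)). The logarithm in the theorem only weakens this bound. -/

/-! ### Sampling without replacement. -/

section RandomPermutation

variable {ι E : Type*} [Fintype ι] [DecidableEq ι] [NormedAddCommGroup E] [InnerProductSpace ℝ E]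

/-- Distinct samples drawn without replacement from a centred family are non-positively
correlated. -/
lemma sum_perm_inner_nonpos {z : ι → E} (hz : ∑ k, z k = 0) {s s' : ι} (hs : s ≠ s') :
    ∑ π : Equiv.Perm ι, inner ℝ (z (π s)) (z (π s')) ≤ 0 := by
  -- Right multiplication by the transposition of `s'` and `u` fixes the value at `s`, so every
  -- partner `u ≠ s` has the same correlation.
  have hsymm : ∀ u ∈ Finset.univ.erase s,
      ∑ π : Equiv.Perm ι, inner ℝ (z (π s)) (z (π u))
        = ∑ π : Equiv.Perm ι, inner ℝ (z (π s)) (z (π s')) := by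
    intro u hu
    rw [← Equiv.sum_comp (Equiv.mulRight (Equiv.swap s' u))]
    refine Finset.sum_congr rfl fun π _ => ?_
    simp [Equiv.swap_apply_of_ne_of_ne hs (Finset.ne_of_mem_erase hu).symm]
  have hsum : ∀ π : Equiv.Perm ι, ∑ u ∈ Finset.univ.erase s, z (π u) = - z (π s) := by
    intro π
    rw [eq_neg_iff_add_eq_zero, Finset.sum_erase_add _ _ (Finset.mem_univ s),
      Equiv.sum_comp π z, hz]
  -- Summed over all partners, the correlation is minus the second moment of `z (π s)`.
  have key : ((Finset.univ.erase s).card : ℝ) *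
      ∑ π : Equiv.Perm ι, inner ℝ (z (π s)) (z (π s')) ≤ 0 := by
    rw [← nsmul_eq_mul, ← Finset.sum_const, ← Finset.sum_congr rfl hsymm, Finset.sum_comm]
    refine Finset.sum_nonpos fun π _ => ?_
    rw [← inner_sum, hsum, inner_neg_right]
    linarith [real_inner_self_nonneg (x := z (π s))]
  have hcard : (0 : ℝ) < ((Finset.univ.erase s).card : ℝ) := by
    exact_mod_cast Finset.card_pos.2 ⟨s', by simp [hs.symm]⟩
  nlinarith

/-- Second moment bound for the sum of a sample drawn without replacement from a centred family. -/
lemma sum_perm_norm_sq_le {z : ι → E} (hz : ∑ k, z k = 0) {D : ℝ} (hD : ∀ k, ‖z k‖ ≤ D)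
    (S : Finset ι) :
    ∑ π : Equiv.Perm ι, ‖∑ s ∈ S, z (π s)‖ ^ 2
      ≤ (Fintype.card ι).factorial * (S.card * D ^ 2) := by
  have hexp : ∀ π : Equiv.Perm ι, ‖∑ s ∈ S, z (π s)‖ ^ 2
      = ∑ s ∈ S, ∑ s' ∈ S, inner ℝ (z (π s)) (z (π s')) := by
    intro π
    rw [← real_inner_self_eq_norm_sq, sum_inner]
    exact Finset.sum_congr rfl fun s _ => inner_sum _ _ _
  simp_rw [hexp]
  rw [Finset.sum_comm]
  have hrow : ∀ s ∈ S, ∑ π : Equiv.Perm ι, ∑ s' ∈ S, inner ℝ (z (π s)) (z (π s'))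
      ≤ (Fintype.card ι).factorial * D ^ 2 := by
    intro s hs
    rw [Finset.sum_comm, ← Finset.add_sum_erase S _ hs]
    have h1 : ∑ s' ∈ S.erase s, ∑ π : Equiv.Perm ι, inner ℝ (z (π s)) (z (π s')) ≤ 0 :=
      Finset.sum_nonpos fun s' hs' => sum_perm_inner_nonpos hz (Finset.ne_of_mem_erase hs').symm
    have h2 : ∑ π : Equiv.Perm ι, inner ℝ (z (π s)) (z (π s))
        ≤ (Fintype.card ι).factorial * D ^ 2 := by
      refine (Finset.sum_le_card_nsmul _ _ (D ^ 2) fun π _ => ?_).trans_eq ?_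
      · rw [real_inner_self_eq_norm_sq]
        exact pow_le_pow_left₀ (norm_nonneg _) (hD _) 2
      · rw [Finset.card_univ, Fintype.card_perm, nsmul_eq_mul]
    linarith
  refine (Finset.sum_le_card_nsmul _ _ _ hrow).trans_eq ?_
  rw [nsmul_eq_mul]
  ring

/-- The summed norm of a sample drawn without replacement from a centred family. -/
lemma sum_perm_norm_le {z : ι → E} (hz : ∑ k, z k = 0) {D : ℝ} (hD0 : 0 ≤ D)
    (hD : ∀ k, ‖z k‖ ≤ D) (S : Finset ι) :
    ∑ π : Equiv.Perm ι, ‖∑ s ∈ S, z (π s)‖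
      ≤ (Fintype.card ι).factorial * (Real.sqrt S.card * D) := by
  -- Cauchy–Schwarz over the permutations reduces this to the second moment.
  refine abs_le_of_sq_le_sq' ?_ (by positivity) |>.2
  have h := sq_sum_le_card_mul_sum_sq (s := (Finset.univ : Finset (Equiv.Perm ι)))
    (f := fun π => ‖∑ s ∈ S, z (π s)‖)
  rw [Finset.card_univ, Fintype.card_perm] at h
  refine h.trans ((mul_le_mul_of_nonneg_left (sum_perm_norm_sq_le hz hD S)
    (Nat.cast_nonneg _)).trans_eq ?_)
  rw [mul_pow, mul_pow, Real.sq_sqrt (Nat.cast_nonneg _)]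
  ring

end RandomPermutation

/-- A nonanticipating bounded predictor is almost uncorrelated with the next sample drawn without
replacement from a centred family. -/
lemma sum_perm_inner_le {T : ℕ} {E : Type*} [NormedAddCommGroup E] [InnerProductSpace ℝ E]
    {z : Fin T → E} (hz : ∑ k, z k = 0) {D : ℝ} (hD0 : 0 ≤ D) (hD : ∀ k, ‖z k‖ ≤ D)
    {f : Equiv.Perm (Fin T) → E} {P : ℝ} (hP : ∀ π, ‖f π‖ ≤ P) (t : Fin T)
    (hf : ∀ π π' : Equiv.Perm (Fin T), (∀ s < t, π s = π' s) → f π = f π') :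
    ∑ π, inner ℝ (f π) (z (π t)) ≤ T.factorial * (P * D * (1 / Real.sqrt (T - t : ℝ))) := by
  -- Exchanging `t` with a later `s` leaves the prefix before `t`, hence `f`, unchanged.
  have hsymm : ∀ s ∈ Finset.Ici t,
      ∑ π, inner ℝ (f π) (z (π s)) = ∑ π, inner ℝ (f π) (z (π t)) := by
    intro s hs
    rw [← Equiv.sum_comp (Equiv.mulRight (Equiv.swap t s))]
    refine Finset.sum_congr rfl fun π _ => ?_
    have : f (π * Equiv.swap t s) = f π := by
      refine hf _ _ fun u hu => ?_
      rw [Equiv.Perm.mul_apply, Equiv.swap_apply_of_ne_of_ne hu.ne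
        (hu.trans_le (Finset.mem_Ici.1 hs)).ne]
    simp [this]
  have hcard : ((Finset.Ici t).card : ℝ) = T - t := by
    rw [Fin.card_Ici, Nat.cast_sub t.2.le]
  have hpos : (0 : ℝ) < T - t := sub_pos.2 (by exact_mod_cast t.2)
  have hP0 : 0 ≤ P := (norm_nonneg _).trans (hP 1)
  have key : (T - t : ℝ) * ∑ π, inner ℝ (f π) (z (π t))
      ≤ P * (T.factorial * (Real.sqrt (T - t : ℝ) * D)) := by
    rw [← hcard, ← nsmul_eq_mul, ← Finset.sum_const, ← Finset.sum_congr rfl hsymm,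
      Finset.sum_comm]
    have h := sum_perm_norm_le hz hD0 hD (Finset.Ici t)
    rw [Fintype.card_fin] at h
    refine le_trans ?_ (mul_le_mul_of_nonneg_left h hP0)
    rw [Finset.mul_sum]
    refine Finset.sum_le_sum fun π _ => ?_
    rw [← inner_sum]
    exact (real_inner_le_norm _ _).trans (mul_le_mul_of_nonneg_right (hP π) (norm_nonneg _))
  have hs : 0 < Real.sqrt (T - t : ℝ) := Real.sqrt_pos.2 hpos
  refine le_of_mul_le_mul_left (key.trans_eq ?_) hpos
  field_simp
  rw [Real.sq_sqrt hpos.le]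

/-! ### Scalar sums and compactness of convex hulls. -/

lemma sum_one_div_sqrt_le (n : ℕ) :
    ∑ t : Fin n, 1 / Real.sqrt ((t : ℝ) + 1) ≤ 2 * Real.sqrt n := by
  induction n with
  | zero => simp
  | succ n ih =>
    rw [Fin.sum_univ_castSucc]
    simp only [Fin.val_castSucc, Fin.val_last, Nat.cast_add, Nat.cast_one]
    have h1 : 0 < Real.sqrt ((n : ℝ) + 1) := Real.sqrt_pos.2 (by positivity)
    have h2 := Real.sq_sqrt (show (0 : ℝ) ≤ (n : ℝ) + 1 by positivity)
    have h3 := Real.sq_sqrt (show (0 : ℝ) ≤ (n : ℝ) by positivity)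
    have h4 : 1 / Real.sqrt ((n : ℝ) + 1)
        ≤ 2 * (Real.sqrt ((n : ℝ) + 1) - Real.sqrt n) := by
      rw [div_le_iff₀ h1]
      nlinarith [sq_nonneg (Real.sqrt ((n : ℝ) + 1) - Real.sqrt n)]
    linarith

lemma sum_one_div_sqrt_sub_le (n : ℕ) :
    ∑ t : Fin n, 1 / Real.sqrt ((n : ℝ) - t) ≤ 2 * Real.sqrt n := by
  refine le_trans (le_of_eq ?_) (sum_one_div_sqrt_le n)
  rw [← Equiv.sum_comp Fin.revPerm]
  refine Finset.sum_congr rfl fun t _ => ?_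
  rw [Fin.revPerm_apply, Fin.val_rev, Nat.cast_sub (by have := t.2; omega)]
  push_cast
  ring_nf

/-- Abel summation bound for telescoping differences with monotone weights. -/
lemma sum_sub_mul_le {T : ℕ} {a : Fin (T + 1) → ℝ} {A : ℝ} (ha : ∀ t, a t ≤ A)
    {c : ℕ → ℝ} (hc : Monotone c) (hc0 : 0 ≤ c 0) :
    ∑ t : Fin T, (a t.castSucc - a t.succ) * c t ≤ (A - a (Fin.last T)) * c T := by
  induction T with
  | zero => simpa using mul_nonneg (sub_nonneg.2 (ha 0)) hc0
  | succ T ih =>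
    rw [Fin.sum_univ_castSucc]
    have h := ih (a := fun t => a t.castSucc) fun t => ha _
    have h1 := mul_le_mul_of_nonneg_left (hc (Nat.le_succ T))
      (sub_nonneg.2 (ha (Fin.last T).castSucc))
    have h2 := mul_le_mul_of_nonneg_left (hc (Nat.le_succ T))
      (sub_nonneg.2 (ha (Fin.last (T + 1))))
    simp only [Fin.succ_castSucc, Fin.val_castSucc, Fin.val_last, Fin.succ_last] at h ⊢
    simp only [Nat.succ_eq_add_one] at *
    linarith

lemma EuclideanSpace.norm_sq_le_card_mul {m : ℕ} {g : EuclideanSpace ℝ (Fin m)} {d : ℝ}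
    (hg : ∀ i, |g i| ≤ d) : ‖g‖ ^ 2 ≤ m * d ^ 2 := by
  rw [EuclideanSpace.real_norm_sq_eq]
  refine (Finset.sum_le_card_nsmul _ _ (d ^ 2) fun i _ => ?_).trans_eq (by simp)
  exact sq_le_sq' (abs_le.1 (hg i)).1 (abs_le.1 (hg i)).2

/-- In finite dimension the convex hull of a compact set is compact. -/
lemma IsCompact.convexHull_of_finiteDimensional {E : Type*} [NormedAddCommGroup E]
    [NormedSpace ℝ E] [FiniteDimensional ℝ E] {s : Set E} (hs : IsCompact s) :
    IsCompact (convexHull ℝ s) := by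
  let N := Module.finrank ℝ E + 1
  let F : (Fin N → ℝ) × (Fin N → E) → E := fun q => ∑ i, q.1 i • q.2 i
  have hF : Continuous F := by fun_prop
  have hK : IsCompact (stdSimplex ℝ (Fin N) ×ˢ Set.univ.pi fun _ : Fin N => s) :=
    (isCompact_stdSimplex ℝ (Fin N)).prod (isCompact_univ_pi fun _ => hs)
  suffices h : convexHull ℝ s = F '' (stdSimplex ℝ (Fin N) ×ˢ Set.univ.pi fun _ : Fin N => s) by
    rw [h]
    exact hK.image hF
  refine Set.Subset.antisymm ?_ ?_
  · intro x hx
    obtain ⟨x₀, hx₀⟩ : s.Nonempty := convexHull_nonempty_iff.1 ⟨x, hx⟩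
    -- Carathéodory. The combination is padded to exactly `N` points, with zero weights and the
    -- filler `x₀`.
    obtain ⟨ι, _, z, w, hz, hind, hw, hw1, rfl⟩ := eq_pos_convex_span_of_mem_convexHull hx
    have hcard : Fintype.card ι ≤ Fintype.card (Fin N) := by
      rw [Fintype.card_fin]
      exact hind.card_le_finrank_succ.trans
        (Nat.succ_le_succ (Submodule.finrank_le _))
    obtain ⟨e⟩ := Function.Embedding.nonempty_of_card_le hcard
    refine ⟨(Function.extend e w 0, Function.extend e z fun _ => x₀),
      ⟨⟨fun j => ?_, ?_⟩, fun j _ => ?_⟩, ?_⟩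
    · by_cases hj : ∃ i, e i = j
      · obtain ⟨i, rfl⟩ := hj
        simpa [e.injective.extend_apply] using (hw i).le
      · simp [Function.extend_apply' _ _ _ hj]
    · change ∑ j, Function.extend e w 0 j = 1
      rw [← hw1]
      refine (Fintype.sum_of_injective e e.injective _ _ (fun j hj => ?_) fun i => ?_).symm
      · simp [Function.extend_apply' _ _ _ hj]
      · simp [e.injective.extend_apply]
    · change Function.extend e z (fun _ => x₀) j ∈ s
      by_cases hj : ∃ i, e i = j
      · obtain ⟨i, rfl⟩ := hj
        rw [e.injective.extend_apply]
        exact hz ⟨i, rfl⟩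
      · rwa [Function.extend_apply' _ _ _ hj]
    · change ∑ j, Function.extend e w 0 j • Function.extend e z (fun _ => x₀) j = _
      refine (Fintype.sum_of_injective e e.injective _ _ (fun j hj => ?_) fun i => ?_).symm
      · simp [Function.extend_apply' _ _ _ hj]
      · simp [e.injective.extend_apply]
  · rintro _ ⟨⟨w, z⟩, ⟨hw, hz⟩, rfl⟩
    exact (convex_convexHull ℝ s).sum_mem (fun i _ => hw.1 i) hw.2
      fun i _ => subset_convexHull ℝ s (hz i trivial)

/-! ### Projection onto the polar cone. -/

section Geometry

variable {m : ℕ} {C : ProperCone ℝ (Vec m)}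

lemma zero_mem_polarCone : (0 : Vec m) ∈ polarCone C := fun v _ => by simp

lemma convex_polarCone : Convex ℝ (polarCone C) := by
  intro x hx y hy a b ha hb _ v hv
  rw [inner_add_left, real_inner_smul_left, real_inner_smul_left]
  nlinarith [mul_nonneg ha (neg_nonneg.2 (hx v hv)), mul_nonneg hb (neg_nonneg.2 (hy v hv))]

lemma isClosed_polarCone : IsClosed (polarCone C) := by
  have : polarCone C = ⋂ v ∈ C, {u : Vec m | inner ℝ u v ≤ 0} := by
    ext u
    simp [polarCone]
  rw [this]
  exact isClosed_biInter fun v _ => isClosed_le (by fun_prop) continuous_const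

lemma exists_isProjection {K : Set (Vec m)} (hK : IsClosed K) (hne : K.Nonempty) (x : Vec m) :
    ∃ q, IsProjection K x q := by
  obtain ⟨q, hq, h⟩ := hK.exists_infDist_eq_dist hne x
  refine ⟨q, hq, fun u hu => ?_⟩
  rw [← dist_eq_norm, ← dist_eq_norm, ← h]
  exact Metric.infDist_le_dist_of_mem hu

lemma IsProjection.inner_le_zero {K : Set (Vec m)} (hK : Convex ℝ K) {x q : Vec m}
    (h : IsProjection K x q) {u : Vec m} (hu : u ∈ K) : inner ℝ (x - q) (u - q) ≤ 0 := by
  refine (norm_eq_iInf_iff_real_inner_le_zero hK h.1).1 ?_ u hu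
  have : Nonempty K := ⟨⟨q, h.1⟩⟩
  exact le_antisymm (le_ciInf fun w => h.2 w w.2)
    (ciInf_le ⟨0, Set.forall_mem_range.2 fun _ => norm_nonneg _⟩ (⟨q, h.1⟩ : K))

lemma IsProjection.unique {K : Set (Vec m)} (hK : Convex ℝ K) {x q q' : Vec m}
    (h : IsProjection K x q) (h' : IsProjection K x q') : q = q' := by
  -- The two variational inequalities add up to `‖q - q'‖ ^ 2 ≤ 0`.
  have h1 := h.inner_le_zero hK h'.1
  have h2 := h'.inner_le_zero hK h.1
  have h3 : inner ℝ (q - q') (q - q') ≤ 0 := by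
    simp only [inner_sub_left, inner_sub_right] at *
    linarith
  rw [real_inner_self_eq_norm_sq] at h3
  exact sub_eq_zero.1 (norm_eq_zero.1 (pow_eq_zero_iff two_ne_zero |>.1
    (le_antisymm h3 (sq_nonneg _))))

lemma IsProjection.norm_le {K : Set (Vec m)} (hK : Convex ℝ K) (h0 : (0 : Vec m) ∈ K)
    {x q : Vec m} (h : IsProjection K x q) : ‖q‖ ≤ ‖x‖ := by
  have h1 := h.inner_le_zero hK h0
  rw [zero_sub, inner_neg_right, inner_sub_left, real_inner_self_eq_norm_sq] at h1
  by_contra! hlt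
  nlinarith [real_inner_le_norm x q, norm_nonneg x, norm_nonneg q]

end Geometry

/-! ### Attainment of the benchmark. -/

section Offline

variable {T m : ℕ} {n : Fin T → ℕ}

lemma LocalVar.continuous_impact {n m : ℕ} :
    Continuous (LocalVar.impact : LocalVar n m → Vec m) := continuous_snd.comp continuous_snd

lemma LocalVar.continuous_reward {n m : ℕ} :
    Continuous (LocalVar.reward : LocalVar n m → ℝ) := continuous_fst

lemma AssumptionA1.isClosed {Ω : ∀ t, Set (LocalVar (n t) m)} {Ψ Q : Set (Vec m)}
    {C : ProperCone ℝ (Vec m)} (h : AssumptionA1 Ω Ψ Q C) : IsClosed Ψ := by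
  rw [h.decomposition]
  exact C.isClosed.add_left_of_isCompact h.compact_Q

/-- The optimal value of the partially convexified problem is attained. -/
lemma isGreatest_zR {Ω : ∀ t, Set (LocalVar (n t) m)} {Ψ Q : Set (Vec m)}
    {C : ProperCone ℝ (Vec m)} (h : AssumptionA1 Ω Ψ Q C) (hT : T ≠ 0) :
    IsGreatest (convexifiedValues Ω Ψ) (zR Ω Ψ) := by
  have hne : (convexifiedValues Ω Ψ).Nonempty := by
    obtain ⟨_, w, hw, hΨ, rfl⟩ := h.feasible
    exact ⟨_, w, fun t => subset_convexHull ℝ _ (hw t), hΨ, rfl⟩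
  have hcl : IsClosed ((T : ℝ) • Ψ) := h.isClosed.smul_of_ne_zero (Nat.cast_ne_zero.2 hT)
  let S : Set (∀ t, LocalVar (n t) m) := Set.univ.pi fun t => convexHull ℝ (Ω t)
  have hS : IsCompact S :=
    isCompact_univ_pi fun t => (h.compact_local t).convexHull_of_finiteDimensional
  have hcomp : IsCompact (S ∩ {w | ∑ t, (w t).impact ∈ (T : ℝ) • Ψ}) :=
    hS.inter_right (hcl.preimage (continuous_finsetSum _ fun t _ =>
      LocalVar.continuous_impact.comp (continuous_apply t)))
  have himg : convexifiedValues Ω Ψ =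
      (fun w : ∀ t, LocalVar (n t) m => ∑ t, (w t).reward) ''
        (S ∩ {w | ∑ t, (w t).impact ∈ (T : ℝ) • Ψ}) := by
    ext z
    constructor
    · rintro ⟨w, hw, hΨ, rfl⟩
      exact ⟨w, ⟨fun t _ => hw t, hΨ⟩, rfl⟩
    · rintro ⟨w, ⟨hw, hΨ⟩, rfl⟩
      exact ⟨w, fun t => hw t trivial, hΨ, rfl⟩
  have hvals : IsCompact (convexifiedValues Ω Ψ) := by
    rw [himg]
    exact hcomp.image (continuous_finsetSum _ fun t _ =>
      LocalVar.continuous_reward.comp (continuous_apply t))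
  exact hvals.isGreatest_sSup hne

end Offline

/-! ### Existence and nonanticipation of online executions. -/

section Execution

variable {T m : ℕ} {n : Fin T → ℕ} {Z : ∀ k, Set (LocalVar (n k) m)} {Q : Set (Vec m)}
  {C : ProperCone ℝ (Vec m)} {η : Fin T → ℝ}

/-- The dual multipliers produced by fixed selections `W`, `V`, `proj` of the local maximizers, the
support points and the projections. -/
noncomputable def dualIterates (W : ∀ k, Vec m → LocalVar (n k) m) (V proj : Vec m → Vec m)
    (η : Fin T → ℝ) (π : Equiv.Perm (Fin T)) : ℕ → Vec m
  | 0 => 0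
  | j + 1 => let q := dualIterates W V proj η π j
      -- The `else` value is junk: only indices up to `T` matter.
      if h : j < T then proj (q - η ⟨j, h⟩ • (V q - (W (π ⟨j, h⟩) q).impact)) else q

lemma dualIterates_congr (W : ∀ k, Vec m → LocalVar (n k) m) (V proj : Vec m → Vec m)
    (η : Fin T → ℝ) {π π' : Equiv.Perm (Fin T)} {j : ℕ}
    (h : ∀ s : Fin T, (s : ℕ) < j → π s = π' s) :
    dualIterates W V proj η π j = dualIterates W V proj η π' j := by
  induction j with
  | zero => rfl
  | succ j ih =>
    simp only [dualIterates]
    rw [ih fun s hs => h s (hs.trans (Nat.lt_succ_self j))]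
    split_ifs with hj
    · rw [h ⟨j, hj⟩ (Nat.lt_succ_self j)]
    · rfl

/-- The algorithm can be carried out online. -/
lemma nonempty_onlineExecution (hZ : ∀ k, IsCompact (Z k)) (hZne : ∀ k, (Z k).Nonempty)
    (hQ : IsCompact Q) (hQne : Q.Nonempty) (η : Fin T → ℝ) :
    Nonempty (OnlineExecution Z Q C η) := by
  have hW : ∀ (k : Fin T) (q : Vec m), ∃ w ∈ Z k, ∀ w' ∈ Z k,
      w'.reward - inner ℝ q w'.impact ≤ w.reward - inner ℝ q w.impact := fun k q =>
    (hZ k).exists_isMaxOn (hZne k) (LocalVar.continuous_reward.sub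
      (continuous_const.inner LocalVar.continuous_impact)).continuousOn
  have hV : ∀ q : Vec m, ∃ v ∈ Q, ∀ v' ∈ Q, inner ℝ q v' ≤ inner ℝ q v := fun q =>
    hQ.exists_isMaxOn hQne (f := fun v => (inner ℝ q v : ℝ)) (by fun_prop)
  choose W hWmem hWmax using hW
  choose V hVmem hVmax using hV
  choose proj hproj using
    exists_isProjection (isClosed_polarCone (C := C)) ⟨0, zero_mem_polarCone⟩
  refine ⟨⟨fun π t => W (π t) (dualIterates W V proj η π t),
    fun π t => V (dualIterates W V proj η π t), fun π t => dualIterates W V proj η π t,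
    fun π => ⟨rfl, fun t => hWmem _ _, fun t => hWmax _ _, fun t => hVmem _, fun t => hVmax _,
      fun t => ?_⟩, fun π π' t h => ?_⟩⟩
  · have : dualIterates W V proj η π (t.succ : ℕ) = proj (dualIterates W V proj η π t -
        η t • (V (dualIterates W V proj η π t) -
          (W (π t) (dualIterates W V proj η π t)).impact)) := by
      simp [dualIterates]
    simp only [this]
    exact hproj _
  · have hq := dualIterates_congr W V proj η (j := t) fun s hs => h s (le_of_lt hs)
    rw [hq, h t le_rfl]
    exact ⟨rfl, rfl⟩

/-- In an online execution the dual multiplier at time `t` depends only on the past. -/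
lemma OnlineExecution.p_congr (A : OnlineExecution Z Q C η) {π π' : Equiv.Perm (Fin T)}
    (t : Fin (T + 1)) (h : ∀ s : Fin T, s.castSucc < t → π s = π' s) : A.p π t = A.p π' t := by
  induction t using Fin.induction with
  | zero => rw [(A.isRun π).init, (A.isRun π').init]
  | succ t ih =>
    have hp := ih fun s hs => h s (hs.trans (Fin.castSucc_lt_succ))
    obtain ⟨hw, hv⟩ := A.nonanticipating π π' t fun s hs =>
      h s (Fin.castSucc_lt_succ_iff.2 hs)
    have himp : (A.w π t).impact = (A.w π' t).impact :=
      congrArg (fun a : Σ k : Fin T, LocalVar (n k) m => a.2.impact) hw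
    have h' := (A.isRun π').update t
    rw [← hp, ← hv, ← himp] at h'
    -- Both multipliers project the same point, and projection onto a convex set is unique.
    exact ((A.isRun π).update t).unique convex_polarCone h'

end Execution

/-! ### Stepsize estimates. -/

section Stepsize

variable {m T : ℕ}

lemma one_div_stepsize (hm : 1 ≤ m) (t : Fin T) :
    1 / stepsize m t = max (m : ℝ) (Real.sqrt (m * ((t : ℝ) + 1))) := by
  have h1 : (0 : ℝ) < m := by exact_mod_cast hm
  have h2 : 0 < Real.sqrt (m * ((t : ℝ) + 1)) := Real.sqrt_pos.2 (by positivity)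
  unfold stepsize
  rcases le_total (m : ℝ) (Real.sqrt (m * ((t : ℝ) + 1))) with h | h
  · rw [max_eq_right h, min_eq_right (one_div_le_one_div_of_le h1 h), one_div_one_div]
  · rw [max_eq_left h, min_eq_left (one_div_le_one_div_of_le h2 h), one_div_one_div]

lemma stepsize_pos (hm : 1 ≤ m) (t : Fin T) : 0 < stepsize m t := by
  have h1 : (0 : ℝ) < m := by exact_mod_cast hm
  exact lt_min (by positivity) (one_div_pos.2 (Real.sqrt_pos.2 (by positivity)))

lemma stepsize_mul_le_one (hm : 1 ≤ m) (t : Fin T) : stepsize m t * m ≤ 1 := by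
  have h1 : (0 : ℝ) < m := by exact_mod_cast hm
  exact (le_div_iff₀ h1).1 (min_le_left _ _)

lemma stepsize_le_one (hm : 1 ≤ m) (t : Fin T) : stepsize m t ≤ 1 := by
  have h1 : (1 : ℝ) ≤ m := by exact_mod_cast hm
  nlinarith [stepsize_mul_le_one hm t, stepsize_pos hm t]

lemma sum_stepsize_mul_le (hm : 1 ≤ m) :
    ∑ t : Fin T, stepsize m t * m ≤ 2 * Real.sqrt (m * T) := by
  have h1 : (0 : ℝ) < m := by exact_mod_cast hm
  have h2 : 0 < Real.sqrt m := Real.sqrt_pos.2 h1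
  have h : ∀ t : Fin T, stepsize m t * m ≤ Real.sqrt m * (1 / Real.sqrt ((t : ℝ) + 1)) := by
    intro t
    have h3 : 0 < Real.sqrt ((t : ℝ) + 1) := Real.sqrt_pos.2 (by positivity)
    refine (mul_le_mul_of_nonneg_right (min_le_right _ _) h1.le).trans_eq ?_
    rw [Real.sqrt_mul h1.le]
    field_simp
    rw [Real.sq_sqrt h1.le]
  refine (Finset.sum_le_sum fun t _ => h t).trans ?_
  rw [← Finset.mul_sum, Real.sqrt_mul h1.le]
  nlinarith [sum_one_div_sqrt_le T]

end Stepsize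

/-! ### Boundedness of the multipliers and regret. -/

section Run

variable {T m : ℕ} {n : Fin T → ℕ} {Ω : ∀ t, Set (LocalVar (n t) m)} {Ψ Q : Set (Vec m)}
  {C : ProperCone ℝ (Vec m)} {η : Fin T → ℝ} {w : ∀ t, LocalVar (n t) m} {v : Fin T → Vec m}
  {p : Fin (T + 1) → Vec m} {dy dr dlow : ℝ}

namespace IsAlgorithmRun

lemma p_mem (h : IsAlgorithmRun Ω Q C η w v p) (t : Fin (T + 1)) : p t ∈ polarCone C := by
  cases t using Fin.cases with
  | zero => rw [h.init]; exact zero_mem_polarCone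
  | succ t => exact (h.update t).1

/-- The local maximizer is optimal over the convex hull of the local set. -/
lemma convexHull_max (h : IsAlgorithmRun Ω Q C η w v p) (t : Fin T) {w' : LocalVar (n t) m}
    (hw' : w' ∈ convexHull ℝ (Ω t)) :
    w'.reward - inner ℝ (p t.castSucc) w'.impact ≤
      (w t).reward - inner ℝ (p t.castSucc) (w t).impact := by
  refine convexHull_min (t := {u : LocalVar (n t) m |
    u.reward - inner ℝ (p t.castSucc) u.impact ≤
      (w t).reward - inner ℝ (p t.castSucc) (w t).impact}) (h.local_max t) ?_ hw'
  refine convex_halfSpace_le ⟨fun x y => ?_, fun c x => ?_⟩ _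
  · change (x.1 + y.1) - inner ℝ (p t.castSucc) (x.2.2 + y.2.2) =
      (x.1 - inner ℝ (p t.castSucc) x.2.2) + (y.1 - inner ℝ (p t.castSucc) y.2.2)
    rw [inner_add_right]
    ring
  · change c * x.1 - inner ℝ (p t.castSucc) (c • x.2.2) =
      c * (x.1 - inner ℝ (p t.castSucc) x.2.2)
    rw [real_inner_smul_right]
    ring

/-- The support point is optimal over the whole goal set. -/
lemma inner_le_of_mem_goal (h : IsAlgorithmRun Ω Q C η w v p)
    (hΨ : Ψ = Q + (C : Set (Vec m))) (t : Fin T) {u : Vec m} (hu : u ∈ Ψ) :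
    inner ℝ (p t.castSucc) u ≤ inner ℝ (p t.castSucc) (v t) := by
  rw [hΨ] at hu
  obtain ⟨a, ha, c, hc, rfl⟩ := hu
  change inner ℝ (p t.castSucc) (a + c) ≤ _
  rw [inner_add_right]
  have h1 := h.support_max t a ha
  have h2 := h.p_mem t.castSucc c hc
  linarith

/-- Strong feasibility makes the dual multipliers drift towards the origin. -/
lemma drift (h : IsAlgorithmRun Ω Q C η w v p) (hΨ : Ψ = Q + (C : Set (Vec m)))
    (h2 : AssumptionA2 Ω Ψ Q dy dr dlow) (hdlow : 0 < dlow) (t : Fin T) :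
    dlow * ‖p t.castSucc‖ - dr ≤ inner ℝ (p t.castSucc) (v t - (w t).impact) := by
  obtain ⟨w', hw', hr, hball⟩ := h2.strongly_feasible t
  have h3 := h.convexHull_max t hw'
  have h4 := hr (w t) (h.local_mem t)
  have h5 : dlow * ‖p t.castSucc‖ + inner ℝ (p t.castSucc) w'.impact
      ≤ inner ℝ (p t.castSucc) (v t) := by
    -- Move from the centre by `dlow` in the direction of the multiplier. If the multiplier is `0`,
    -- the inverse is `0` and the point is the centre itself.
    have hmem : w'.impact + (dlow * ‖p t.castSucc‖⁻¹) • p t.castSucc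
        ∈ Metric.closedBall w'.impact dlow := by
      rw [mem_closedBall_iff_norm, add_sub_cancel_left, norm_smul, Real.norm_eq_abs,
        abs_of_nonneg (by positivity), mul_assoc]
      exact mul_le_of_le_one_right hdlow.le (inv_mul_le_one)
    refine le_trans (le_of_eq ?_) (h.inner_le_of_mem_goal hΨ t (hball hmem))
    rw [inner_add_right, real_inner_smul_right, real_inner_self_eq_norm_sq]
    rcases eq_or_ne ‖p t.castSucc‖ 0 with h0 | h0
    · rw [h0]; ring
    · field_simp
      ring
  rw [inner_sub_right]
  linarith

/-- Projecting onto a convex set containing `0` does not increase the norm; the rest is expanding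
the square. -/
lemma norm_sq_succ_le (h : IsAlgorithmRun Ω Q C η w v p)
    (h2 : AssumptionA2 Ω Ψ Q dy dr dlow) (t : Fin T) :
    ‖p t.succ‖ ^ 2 ≤ ‖p t.castSucc‖ ^ 2
      - 2 * η t * inner ℝ (p t.castSucc) (v t - (w t).impact) + η t ^ 2 * (m * dy ^ 2) := by
  have h3 := (h.update t).norm_le convex_polarCone zero_mem_polarCone
  have h4 : ‖v t - (w t).impact‖ ^ 2 ≤ m * dy ^ 2 := by
    refine EuclideanSpace.norm_sq_le_card_mul fun i => ?_
    rw [PiLp.sub_apply, abs_sub_comm]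
    exact h2.bounded_impact t _ (h.local_mem t) _ (h.support_mem t) i
  refine (pow_le_pow_left₀ (norm_nonneg _) h3 2).trans ?_
  rw [norm_sub_sq_real, real_inner_smul_right, norm_smul, mul_pow, Real.norm_eq_abs, sq_abs]
  nlinarith [mul_le_mul_of_nonneg_left h4 (sq_nonneg (η t))]

end IsAlgorithmRun

/-- The uniform bound on the squared norm of the dual multipliers. -/
noncomputable def dualBound (dy dr dlow : ℝ) : ℝ :=
  ((2 * dr + dy ^ 2) / (2 * dlow)) ^ 2 + (2 * dr + dy ^ 2)

lemma dualBound_nonneg (hdr : 0 ≤ dr) : 0 ≤ dualBound dy dr dlow := by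
  unfold dualBound
  positivity

namespace IsAlgorithmRun

/-- The cap `1/m` on the stepsize makes the quadratic term at most `η * dy ^ 2`, free of the
dimension. Beyond the threshold `B` the drift dominates and the norm cannot grow; below it, one step
adds at most `2 * dr + dy ^ 2` to the square. -/
lemma norm_sq_le (hm : 1 ≤ m) (hdr : 0 ≤ dr) (hdlow : 0 < dlow)
    (h : IsAlgorithmRun Ω Q C (stepsize m) w v p) (hΨ : Ψ = Q + (C : Set (Vec m)))
    (h2 : AssumptionA2 Ω Ψ Q dy dr dlow) (t : Fin (T + 1)) :
    ‖p t‖ ^ 2 ≤ dualBound dy dr dlow := by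
  induction t using Fin.induction with
  | zero =>
    rw [h.init, norm_zero]
    simpa using dualBound_nonneg hdr
  | succ t ih =>
    have h3 := h.norm_sq_succ_le h2 t
    have h4 := h.drift hΨ h2 hdlow t
    have hη := stepsize_pos hm t
    have hη1 := stepsize_le_one hm t
    have hηm := stepsize_mul_le_one hm t
    set B := (2 * dr + dy ^ 2) / (2 * dlow) with hB
    have hBd : 2 * dlow * B = 2 * dr + dy ^ 2 := by rw [hB]; field_simp
    set N := ‖p t.castSucc‖
    set g : ℝ := inner ℝ (p t.castSucc) (v t - (w t).impact)
    have hN : 0 ≤ N := norm_nonneg _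
    have h5 : stepsize m t ^ 2 * (m * dy ^ 2) ≤ stepsize m t * dy ^ 2 := by
      nlinarith [mul_le_mul_of_nonneg_right hηm (mul_nonneg hη.le (sq_nonneg dy))]
    have h6 := mul_le_mul_of_nonneg_left h4 hη.le
    have h7 : ‖p t.succ‖ ^ 2 ≤ N ^ 2 + stepsize m t * (2 * dlow * (B - N)) := by
      nlinarith
    rcases le_total B N with hBN | hBN
    · have := mul_nonneg hη.le (mul_nonneg (mul_nonneg zero_le_two hdlow.le)
        (sub_nonneg.2 hBN))
      nlinarith
    · have h8 : stepsize m t * (2 * dlow * (B - N)) ≤ 2 * dlow * (B - N) :=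
        mul_le_of_le_one_left (mul_nonneg (mul_nonneg zero_le_two hdlow.le)
          (sub_nonneg.2 hBN)) hη1
      have h9 : N ^ 2 ≤ B ^ 2 := pow_le_pow_left₀ hN hBN 2
      have h10 : 0 ≤ dlow * N := by positivity
      change _ ≤ B ^ 2 + (2 * dr + dy ^ 2)
      linarith

/-- The regret of projected online gradient descent against the origin. -/
lemma regret_le (hm : 1 ≤ m) (hdr : 0 ≤ dr) (hdlow : 0 < dlow)
    (h : IsAlgorithmRun Ω Q C (stepsize m) w v p) (hΨ : Ψ = Q + (C : Set (Vec m)))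
    (h2 : AssumptionA2 Ω Ψ Q dy dr dlow) (hmT : m ≤ T) :
    ∑ t, inner ℝ (p t.castSucc) (v t - (w t).impact)
      ≤ (dualBound dy dr dlow + dy ^ 2) * Real.sqrt (m * T) := by
  have hm0 : (1 : ℝ) ≤ m := by exact_mod_cast hm
  have hmT' : (m : ℝ) ≤ T := by exact_mod_cast hmT
  -- The inverse stepsizes; their monotonicity permits Abel summation.
  let c : ℕ → ℝ := fun t => max (m : ℝ) (Real.sqrt (m * ((t : ℝ) + 1)))
  have hc : Monotone c := by
    intro a b hab
    have : (a : ℝ) ≤ b := by exact_mod_cast hab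
    exact max_le_max le_rfl (Real.sqrt_le_sqrt (by gcongr))
  have hcT : c T ≤ 2 * Real.sqrt (m * T) := by
    refine max_le ?_ ?_
    -- The cap `m` is absorbed because `m ≤ T`.
    · have : (m : ℝ) ≤ Real.sqrt (m * T) := Real.le_sqrt_of_sq_le (by nlinarith)
      linarith [Real.sqrt_nonneg (m * T : ℝ)]
    · rw [Real.sqrt_le_left (by positivity), mul_pow, Real.sq_sqrt (by positivity)]
      nlinarith
  have hstep : ∀ t : Fin T, inner ℝ (p t.castSucc) (v t - (w t).impact)
      ≤ (‖p t.castSucc‖ ^ 2 - ‖p t.succ‖ ^ 2) * c t / 2 + stepsize m t * m * (dy ^ 2 / 2) := by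
    intro t
    have h3 := h.norm_sq_succ_le h2 t
    have hη := stepsize_pos hm t
    rw [show c t = 1 / stepsize m t from (one_div_stepsize hm t).symm]
    rw [← mul_le_mul_iff_of_pos_left (mul_pos two_pos hη)]
    have : 2 * stepsize m t * ((‖p t.castSucc‖ ^ 2 - ‖p t.succ‖ ^ 2) * (1 / stepsize m t) / 2
        + stepsize m t * m * (dy ^ 2 / 2))
        = (‖p t.castSucc‖ ^ 2 - ‖p t.succ‖ ^ 2) + stepsize m t ^ 2 * (m * dy ^ 2) := by
      field_simp
    rw [this]
    linarith
  refine (Finset.sum_le_sum fun t _ => hstep t).trans ?_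
  rw [Finset.sum_add_distrib, ← Finset.sum_div, ← Finset.sum_mul]
  have h4 := sum_sub_mul_le (a := fun t => ‖p t‖ ^ 2)
    (fun t => h.norm_sq_le hm hdr hdlow hΨ h2 t) hc ((Nat.cast_nonneg m).trans (le_max_left _ _))
  have h5 : (dualBound dy dr dlow - ‖p (Fin.last T)‖ ^ 2) * c T
      ≤ dualBound dy dr dlow * (2 * Real.sqrt (m * T)) :=
    mul_le_mul (sub_le_self _ (sq_nonneg _)) hcT
      ((Nat.cast_nonneg m).trans (le_max_left _ _)) (dualBound_nonneg hdr)
  have h6 := mul_le_mul_of_nonneg_right (sum_stepsize_mul_le (T := T) hm)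
    (by positivity : 0 ≤ dy ^ 2 / 2)
  linarith

end IsAlgorithmRun

end Run

/-! ### Comparison with a convexified solution. -/

section Centering

variable {T m : ℕ} {n : Fin T → ℕ} {Z : ∀ k, Set (LocalVar (n k) m)} {Ψ Q : Set (Vec m)}
  {C : ProperCone ℝ (Vec m)} {dy dr dlow : ℝ}

/-- Balls are convex, so the bound passes to the hull; `√m` is the price of going from the sup norm
to the Euclidean norm. -/
lemma AssumptionA2.norm_impact_sub_le (h : AssumptionA2 Z Ψ Q dy dr dlow) (hdy : 0 ≤ dy)
    (k : Fin T) {w : LocalVar (n k) m} (hw : w ∈ convexHull ℝ (Z k)) {v : Vec m} (hv : v ∈ Q) :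
    ‖w.impact - v‖ ≤ dy * Real.sqrt m := by
  have hconv : Convex ℝ {u : LocalVar (n k) m | u.impact ∈ Metric.closedBall v (dy * √m)} :=
    (convex_closedBall v _).is_linear_preimage (f := LocalVar.impact)
      ⟨fun _ _ => rfl, fun _ _ => rfl⟩
  have hmem := convexHull_min (fun u hu => ?_) hconv hw
  · rwa [Set.mem_ofPred_eq, mem_closedBall_iff_norm] at hmem
  · rw [Set.mem_ofPred_eq, mem_closedBall_iff_norm]
    refine abs_le_of_sq_le_sq' ?_ (by positivity) |>.2
    rw [mul_pow, Real.sq_sqrt (Nat.cast_nonneg m), mul_comm]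
    exact EuclideanSpace.norm_sq_le_card_mul fun i => by
      rw [PiLp.sub_apply]
      exact h.bounded_impact k u hu v hv i

/-- The deviation of the impacts of a family in the convex hulls from their mean. -/
lemma AssumptionA2.norm_impact_sub_mean_le (h : AssumptionA2 Z Ψ Q dy dr dlow) (hdy : 0 ≤ dy)
    (hQ : Q.Nonempty) (hT : 0 < T) {w : ∀ k, LocalVar (n k) m}
    (hw : ∀ k, w k ∈ convexHull ℝ (Z k)) {ψ : Vec m} (hψ : ∑ k, (w k).impact = (T : ℝ) • ψ)
    (k : Fin T) : ‖(w k).impact - ψ‖ ≤ 2 * dy * Real.sqrt m := by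
  -- The mean `ψ` need not lie in `Q`, so both vectors are compared with a reference point `v` of
  -- `Q`.
  obtain ⟨v, hv⟩ := hQ
  have hT' : (0 : ℝ) < T := by exact_mod_cast hT
  have h1 : (T : ℝ) • (ψ - v) = ∑ k, ((w k).impact - v) := by
    rw [Finset.sum_sub_distrib, hψ, smul_sub]
    simp [Nat.cast_smul_eq_nsmul]
  have h2 : (T : ℝ) * ‖ψ - v‖ ≤ T * (dy * √m) := by
    rw [← abs_of_pos hT', ← Real.norm_eq_abs, ← norm_smul, h1, Real.norm_eq_abs, abs_of_pos hT']
    refine (norm_sum_le _ _).trans ((Finset.sum_le_card_nsmul _ _ _ fun k _ =>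
      h.norm_impact_sub_le hdy k (hw k) hv).trans_eq ?_)
    simp
  have h3 := le_of_mul_le_mul_left h2 hT'
  have h4 := h.norm_impact_sub_le hdy k (hw k) hv
  rw [← sub_sub_sub_cancel_right _ _ v]
  refine (norm_sub_le _ _).trans ?_
  linarith

/-- The reward of a run compared with a family in the convex hulls and a point of the goal set. -/
lemma IsAlgorithmRun.le_sum_reward {Ω : ∀ t, Set (LocalVar (n t) m)} {η : Fin T → ℝ}
    {w : ∀ t, LocalVar (n t) m} {v : Fin T → Vec m} {p : Fin (T + 1) → Vec m}
    (h : IsAlgorithmRun Ω Q C η w v p) (hΨ : Ψ = Q + (C : Set (Vec m)))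
    {u : ∀ t, LocalVar (n t) m} (hu : ∀ t, u t ∈ convexHull ℝ (Ω t)) {ψ : Vec m} (hψ : ψ ∈ Ψ) :
    ∑ t, (u t).reward - ∑ t, inner ℝ (p t.castSucc) ((u t).impact - ψ)
      - ∑ t, inner ℝ (p t.castSucc) (v t - (w t).impact) ≤ ∑ t, (w t).reward := by
  rw [← Finset.sum_sub_distrib, ← Finset.sum_sub_distrib]
  refine Finset.sum_le_sum fun t _ => ?_
  have h1 := h.convexHull_max t (hu t)
  have h2 := h.inner_le_of_mem_goal hΨ t hψ
  rw [inner_sub_right, inner_sub_right]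
  linarith

end Centering

lemma le_permExpectation {T : ℕ} {f : Equiv.Perm (Fin T) → ℝ} {a : ℝ}
    (h : (T.factorial : ℝ) * a ≤ ∑ π, f π) : a ≤ permExpectation f := by
  have : (0 : ℝ) < T.factorial := by exact_mod_cast T.factorial_pos
  rw [permExpectation, le_div_iff₀ this]
  linarith

/-! ### Averaging over permutations. -/

section Expectation

variable {T m : ℕ} {n : Fin T → ℕ} {Z : ∀ k, Set (LocalVar (n k) m)} {Ψ Q : Set (Vec m)}
  {C : ProperCone ℝ (Vec m)} {dy dr dlow : ℝ}

/-- The expected reward against the convexified optimum, with an error of order `√(m T)`. -/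
lemma OnlineExecution.le_permExpectation_totalReward (A : OnlineExecution Z Q C (stepsize m))
    (hm : 1 ≤ m) (hmT : m ≤ T) (hdy : 0 ≤ dy) (hdr : 0 ≤ dr) (hdlow : 0 < dlow)
    (h1 : AssumptionA1 Z Ψ Q C) (h2 : AssumptionA2 Z Ψ Q dy dr dlow)
    {z : ℝ} (hz : z ∈ convexifiedValues Z Ψ) :
    z - (4 * Real.sqrt (dualBound dy dr dlow) * dy + (dualBound dy dr dlow + dy ^ 2))
      * Real.sqrt (m * T) ≤ permExpectation A.totalReward := by
  obtain ⟨u, hu, ⟨ψ, hψ, hsum⟩, rfl⟩ := hz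
  have hT : 0 < T := hm.trans hmT
  have hQ : Q.Nonempty := by
    rw [h1.decomposition] at hψ
    obtain ⟨a, ha, -⟩ := hψ
    exact ⟨a, ha⟩
  set P := Real.sqrt (dualBound dy dr dlow) with hP
  have h2π : ∀ π : Equiv.Perm (Fin T),
      AssumptionA2 (fun t => Z (π t)) Ψ Q dy dr dlow := fun π =>
    ⟨fun t => h2.bounded_impact (π t), fun t => h2.strongly_feasible (π t)⟩
  have hcent : ∑ k, ((u k).impact - ψ) = 0 := by
    rw [Finset.sum_sub_distrib, ← hsum]
    simp [Nat.cast_smul_eq_nsmul]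
  have hstep : ∀ t : Fin T, ∑ π, inner ℝ (A.p π t.castSucc) ((u (π t)).impact - ψ)
      ≤ T.factorial * (P * (2 * dy * √m) * (1 / √(T - t : ℝ))) := fun t =>
    sum_perm_inner_le (z := fun k => (u k).impact - ψ) hcent (by positivity)
      (h2.norm_impact_sub_mean_le hdy hQ hT hu hsum.symm)
      (fun π => Real.le_sqrt_of_sq_le
        ((A.isRun π).norm_sq_le hm hdr hdlow h1.decomposition (h2π π) _)) t
      fun π π' hππ' => A.p_congr _ fun s hs => hππ' s (Fin.castSucc_lt_castSucc_iff.1 hs)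
  have hcorr : ∑ π, ∑ t, inner ℝ (A.p π (Fin.castSucc t)) ((u (π t)).impact - ψ)
      ≤ T.factorial * (4 * P * dy * √(m * T)) := by
    rw [Finset.sum_comm]
    refine (Finset.sum_le_sum fun t _ => hstep t).trans ?_
    rw [← Finset.mul_sum, ← Finset.mul_sum]
    refine mul_le_mul_of_nonneg_left ?_ (Nat.cast_nonneg _)
    refine (mul_le_mul_of_nonneg_left (sum_one_div_sqrt_sub_le T) (by positivity)).trans_eq ?_
    rw [Real.sqrt_mul (Nat.cast_nonneg m)]
    ring
  have hrun : ∀ π : Equiv.Perm (Fin T), ∑ k, (u k).reward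
      - ∑ t, inner ℝ (A.p π (Fin.castSucc t)) ((u (π t)).impact - ψ)
      - (dualBound dy dr dlow + dy ^ 2) * √(m * T) ≤ A.totalReward π := by
    intro π
    have h3 := (A.isRun π).le_sum_reward h1.decomposition (u := fun t => u (π t))
      (fun t => hu (π t)) hψ
    have h4 := (A.isRun π).regret_le hm hdr hdlow h1.decomposition (h2π π) hmT
    have h5 := Equiv.sum_comp π fun k => (u k).reward
    rw [OnlineExecution.totalReward]
    linarith
  refine le_permExpectation (le_trans ?_ (Finset.sum_le_sum fun π _ => hrun π))
  rw [Finset.sum_sub_distrib, Finset.sum_sub_distrib, Finset.sum_const, Finset.sum_const,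
    Finset.card_univ, Fintype.card_perm, Fintype.card_fin, nsmul_eq_mul, nsmul_eq_mul]
  linarith

end Expectation

theorem mainTheorem1 (dy dr dlow : ℝ) (hdy : 0 ≤ dy) (hdr : 0 ≤ dr) (hdlow : 0 < dlow) :
    ∃ K : ℝ, 0 < K ∧
      ∀ (m T : ℕ), 1 ≤ m → m ≤ T →
      ∀ (n : Fin T → ℕ) (Z : ∀ k, Set (LocalVar (n k) m))
        (Ψ Q : Set (Vec m)) (C : ProperCone ℝ (Vec m)),
        AssumptionA1 Z Ψ Q C → AssumptionA2 Z Ψ Q dy dr dlow →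
        IsGreatest (convexifiedValues Z Ψ) (zR Z Ψ) ∧
        Nonempty (OnlineExecution Z Q C (stepsize m)) ∧
        ∀ A : OnlineExecution Z Q C (stepsize m),
          zR Z Ψ - K * (Real.sqrt (m * Real.log (max m 2)) * Real.sqrt T) ≤
            permExpectation A.totalReward := by
  set K₀ := 4 * Real.sqrt (dualBound dy dr dlow) * dy + (dualBound dy dr dlow + dy ^ 2) with hK₀
  have hB : 0 ≤ dualBound dy dr dlow := dualBound_nonneg hdr
  have hK₀0 : 0 ≤ K₀ := by positivity
  have hlog : 0 < Real.log 2 := Real.log_pos one_lt_two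
  -- Dividing by `√(log 2)` absorbs the logarithmic factor, which is at least that; the `+ 1` keeps
  -- the constant positive when `K₀ = 0`.
  refine ⟨(K₀ + 1) / √(Real.log 2), by positivity, ?_⟩
  intro m T hm hmT n Z Ψ Q C h1 h2
  have hT : T ≠ 0 := by omega
  have hgreatest := isGreatest_zR h1 hT
  obtain ⟨_, w, hw, ⟨ψ, hψ, -⟩, -⟩ := h1.feasible
  have hQ : Q.Nonempty := by
    rw [h1.decomposition] at hψ
    obtain ⟨a, ha, -⟩ := hψ
    exact ⟨a, ha⟩
  refine ⟨hgreatest, nonempty_onlineExecution h1.compact_local (fun k => ⟨w k, hw k⟩)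
    h1.compact_Q hQ _, fun A => ?_⟩
  refine le_trans ?_
    (A.le_permExpectation_totalReward hm hmT hdy hdr hdlow h1 h2 hgreatest.1)
  have hlog2 : Real.log 2 ≤ Real.log (max m 2) :=
    Real.log_le_log two_pos (le_max_right _ _)
  have hsqrt : √(m * T : ℝ) * √(Real.log 2) ≤ √(m * Real.log (max m 2)) * √T := by
    rw [← Real.sqrt_mul (by positivity),
      ← Real.sqrt_mul (mul_nonneg (Nat.cast_nonneg m) (hlog.le.trans hlog2))]
    refine Real.sqrt_le_sqrt ?_
    have : (0 : ℝ) ≤ m * T := by positivity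
    nlinarith
  have hs : 0 < √(Real.log 2) := Real.sqrt_pos.2 hlog
  have hfin : K₀ * √(m * T : ℝ) ≤
      (K₀ + 1) / √(Real.log 2) * (√(m * Real.log (max m 2)) * √T) := by
    rw [div_mul_eq_mul_div, le_div_iff₀ hs, mul_assoc]
    exact mul_le_mul (by linarith) hsqrt (by positivity) (by linarith)
  linarith
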